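/- Let $k\ge 1$ be an integer and let $f:\{1,2,3,\dots\}\to(0,\infty)$ satisfy $\sum_{j=1}^{\infty}1/f(j)<\infty$. Consider an urn that initially contains $k$ white balls and one red ball. At each step one ball is picked, put back, and one further ball of the same colour is added; if the urn contains $w$ white and $r$ red balls, the picked ball is white with probability $\frac{f(w)}{f(w)+f(r)}$ and red with probability $\frac{f(r)}{f(w)+f(r)}$, given the past. Let $\mathbb P^{(k)}$ be the law of this process and put $F_k=\sum_{j=k}^{\infty}1/f(j)$. Then $$\mathbb P^{(k)}\big(\text{only finitely many white balls are picked}\big)\le \frac12\prod_{\ell=1}^{k-1}\frac{f(\ell)F_k}{1+f(\ell)F_k},$$ where the empty product (for $k=1$) equals $1$. -/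

import Mathlib

open MeasureTheory ProbabilityTheory

/-- The probability that a white ball is picked from an urn with `w` white and `r` red balls under
the reinforcement scheme `f`, namely `f w / (f w + f r)`. The projection to `[0, 1]` has no effect
when `f w` and `f r` are positive (see `whiteProb_eq`); it makes the value a probability for every
real function `f`. -/
noncomputable def whiteProb (f : ℕ → ℝ) (w r : ℕ) : ℝ :=
  (Set.projIcc (0 : ℝ) 1 zero_le_one (f w / (f w + f r)) : ℝ)

lemma whiteProb_nonneg (f : ℕ → ℝ) (w r : ℕ) : 0 ≤ whiteProb f w r :=
  (Set.projIcc (0 : ℝ) 1 zero_le_one (f w / (f w + f r))).2.1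

lemma whiteProb_le_one (f : ℕ → ℝ) (w r : ℕ) : whiteProb f w r ≤ 1 :=
  (Set.projIcc (0 : ℝ) 1 zero_le_one (f w / (f w + f r))).2.2

lemma whiteProb_eq {f : ℕ → ℝ} {w r : ℕ} (hw : 0 < f w) (hr : 0 < f r) :
    whiteProb f w r = f w / (f w + f r) := by
  have h : f w / (f w + f r) ∈ Set.Icc (0 : ℝ) 1 :=
    ⟨by positivity, (div_le_one (by positivity)).2 (by linarith)⟩
  rw [whiteProb, Set.projIcc_of_mem _ h]

/-- The law of the composition (number of white balls, number of red balls) of the urn after one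
draw, if the composition before the draw is `s`. The ball that is picked is put back together with
one more ball of its colour. -/
noncomputable def urnStep (f : ℕ → ℝ) (s : ℕ × ℕ) : Measure (ℕ × ℕ) :=
  ENNReal.ofReal (whiteProb f s.1 s.2) • Measure.dirac (s.1 + 1, s.2) +
    ENNReal.ofReal (1 - whiteProb f s.1 s.2) • Measure.dirac (s.1, s.2 + 1)

instance urnStep_isProbabilityMeasure (f : ℕ → ℝ) (s : ℕ × ℕ) :
    IsProbabilityMeasure (urnStep f s) := by
  constructor
  have h0 := whiteProb_nonneg f s.1 s.2
  have h1 := whiteProb_le_one f s.1 s.2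
  simp only [urnStep, Measure.add_apply, Measure.smul_apply, measure_univ, smul_eq_mul, mul_one]
  rw [← ENNReal.ofReal_add h0 (by linarith)]
  simp

/-- The transition kernel of the urn, as a function of the whole history of compositions up to
time `n`; it depends on the current composition only. -/
noncomputable def urnKernel (f : ℕ → ℝ) (n : ℕ) :
    Kernel ((i : Finset.Iic n) → (fun _ : ℕ => ℕ × ℕ) i) (ℕ × ℕ) :=
  (Kernel.ofFunOfCountable (urnStep f)).comap (fun x => x ⟨n, Finset.mem_Iic.2 le_rfl⟩)
    (measurable_pi_apply _)

instance urnKernel_isMarkovKernel (f : ℕ → ℝ) (n : ℕ) : IsMarkovKernel (urnKernel f n) :=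
  ⟨fun x => urnStep_isProbabilityMeasure f (x ⟨n, Finset.mem_Iic.2 le_rfl⟩)⟩

/-- The law of the reinforced urn model with parameters `k` and `f`: the law on sequences of
compositions (white, red) of the Markov chain that starts with `k` white balls and one red ball and
moves according to `urnStep f`. -/
noncomputable def rumLaw (k : ℕ) (f : ℕ → ℝ) : Measure (ℕ → ℕ × ℕ) :=
  Kernel.traj (X := fun _ => ℕ × ℕ) (urnKernel f) 0 (fun _ => (k, 1))

instance rumLaw_isProbabilityMeasure (k : ℕ) (f : ℕ → ℝ) : IsProbabilityMeasure (rumLaw k f) :=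
  inferInstanceAs (IsProbabilityMeasure
    (Kernel.traj (X := fun _ => ℕ × ℕ) (urnKernel f) 0 (fun _ => (k, 1))))

/-- The event that only finitely many white balls are picked: the number of white balls increases
at finitely many draws only. -/
def finitelyManyWhite : Set (ℕ → ℕ × ℕ) :=
  {x | {n : ℕ | (x (n + 1)).1 = (x n).1 + 1}.Finite}

/-- The tail sum `F_k = ∑_{j ≥ k} 1 / f j`. -/
noncomputable def tailSum (f : ℕ → ℝ) (k : ℕ) : ℝ :=
  ∑' j : ℕ, 1 / f (k + j)

/-!
The event that red overtakes white can be controlled through the finite-horizon quantity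
`q_n(w, r) = P(w_n < r_n) + P(w_n = r_n) / 2`, where `(w_n, r_n)` is the urn after `n` draws from
`(w, r)`. It solves the one-step recursion `q_{n+1} = stepMean f q_n`, and exchanging the colours
gives `q_n(w, r) + q_n(r, w) = 1`, so `q_n = 1/2` on the diagonal (`leadProb_diag`).

Below the diagonal, the product `B(w, r) = ∏_{r ≤ l < w} f l F_w / (1 + f l F_w)` is superharmonic
for the urn (`stepMean_overtakeBound_le`): a red draw removes the factor of `l = r`, and a
white draw multiplies `B` by at most `F_{w+1} / F_w`; the average of the two does not exceed
`B(w, r)` because `f w * F_w = 1 + f w * F_{w+1}`. As `B = 1` on the diagonal, induction on `n`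
yields `q_n ≤ B / 2` for `r ≤ w` (`leadProb_le`).

Finally, if only finitely many white balls are picked, then `w_n < r_n` for all large `n`, whence the
probability of this event is at most `sup_n q_n(k, 1) ≤ B(k, 1) / 2`.
-/

/-! ### The one-step average of the urn -/

/-- The expectation of `g` at the composition of the urn after one draw from the composition `s`. -/
noncomputable def stepMean (f : ℕ → ℝ) (g : ℕ × ℕ → ℝ) (s : ℕ × ℕ) : ℝ :=
  whiteProb f s.1 s.2 * g (s.1 + 1, s.2) + (1 - whiteProb f s.1 s.2) * g (s.1, s.2 + 1)

lemma stepMean_nonneg (f : ℕ → ℝ) {g : ℕ × ℕ → ℝ} (hg : ∀ s, 0 ≤ g s) (s : ℕ × ℕ) :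
    0 ≤ stepMean f g s :=
  add_nonneg (mul_nonneg (whiteProb_nonneg f _ _) (hg _))
    (mul_nonneg (sub_nonneg.2 (whiteProb_le_one f _ _)) (hg _))

lemma lintegral_urnStep (f : ℕ → ℝ) (G : ℕ × ℕ → ENNReal) (s : ℕ × ℕ) :
    ∫⁻ y, G y ∂urnStep f s = ENNReal.ofReal (whiteProb f s.1 s.2) * G (s.1 + 1, s.2) +
      ENNReal.ofReal (1 - whiteProb f s.1 s.2) * G (s.1, s.2 + 1) := by
  simp [urnStep, lintegral_add_measure, lintegral_smul_measure]

lemma lintegral_ofReal_urnStep (f : ℕ → ℝ) {g : ℕ × ℕ → ℝ} (hg : ∀ s, 0 ≤ g s) (s : ℕ × ℕ) :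
    ∫⁻ y, ENNReal.ofReal (g y) ∂urnStep f s = ENNReal.ofReal (stepMean f g s) := by
  have h0 := whiteProb_nonneg f s.1 s.2
  have h1 := sub_nonneg.2 (whiteProb_le_one f s.1 s.2)
  rw [lintegral_urnStep, stepMean, ENNReal.ofReal_add (mul_nonneg h0 (hg _)) (mul_nonneg h1 (hg _)),
    ENNReal.ofReal_mul h0, ENNReal.ofReal_mul h1]

/-! ### The law of the urn process -/

/-- The Markov property of the urn process for two consecutive times. -/
lemma lintegral_rumLaw_succ (k : ℕ) (f : ℕ → ℝ) (n : ℕ) (G : ℕ × ℕ → ℕ × ℕ → ENNReal) :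
    ∫⁻ x, G (x n) (x (n + 1)) ∂rumLaw k f =
      ∫⁻ x, ∫⁻ y, G (x n) y ∂urnStep f (x n) ∂rumLaw k f := by
  have hG : Measurable (Function.uncurry G) := measurable_of_countable _
  let e : ((i : Finset.Iic n) → ℕ × ℕ) → ℕ × ℕ := fun x => x ⟨n, Finset.mem_Iic.2 le_rfl⟩
  have he : Measurable e := measurable_pi_apply _
  have hG' : Measurable fun p : ((i : Finset.Iic n) → ℕ × ℕ) × (ℕ × ℕ) => G (e p.1) p.2 :=
    hG.comp ((he.comp measurable_fst).prodMk measurable_snd)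
  have key := Kernel.partialTraj_compProd_eq_map_traj (X := fun _ => ℕ × ℕ) (κ := urnKernel f)
    (Nat.zero_le n) (x₀ := fun _ => (k, 1))
  have h1 := congrArg (fun μ => ∫⁻ p, G (e p.1) p.2 ∂μ) key
  rw [Measure.lintegral_compProd hG', lintegral_map hG' (by fun_prop),
    ← Kernel.traj_map_frestrictLe_apply,
    lintegral_map hG'.lintegral_kernel_prod_right' (by fun_prop)] at h1
  exact h1.symm

lemma rumLaw_ae_zero (k : ℕ) (f : ℕ → ℝ) : ∀ᵐ x ∂rumLaw k f, x 0 = (k, 1) := by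
  have h := Kernel.traj_map_frestrictLe_apply (X := fun _ => ℕ × ℕ) (κ := urnKernel f) 0 0
    (fun _ => (k, 1))
  rw [Kernel.partialTraj_self, Kernel.id_apply] at h
  have h2 : ∀ᵐ y ∂(Kernel.traj (X := fun _ => ℕ × ℕ) (urnKernel f) 0 (fun _ => (k, 1))).map
      (Preorder.frestrictLe 0), y ⟨0, Finset.mem_Iic.2 le_rfl⟩ = (k, 1) := by
    rw [h]
    exact (ae_dirac_iff (measurableSet_eq_fun (measurable_pi_apply _) measurable_const)).2 rfl
  exact ae_of_ae_map (by fun_prop) h2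

lemma rumLaw_ae_step (k : ℕ) (f : ℕ → ℝ) :
    ∀ᵐ x ∂rumLaw k f, ∀ n, x (n + 1) = ((x n).1 + 1, (x n).2) ∨
      x (n + 1) = ((x n).1, (x n).2 + 1) := by
  classical
  refine ae_all_iff.2 fun n => ?_
  let G : ℕ × ℕ → ℕ × ℕ → ENNReal := fun s y =>
    if y = (s.1 + 1, s.2) ∨ y = (s.1, s.2 + 1) then 0 else 1
  have h : ∫⁻ x, G (x n) (x (n + 1)) ∂rumLaw k f = 0 := by
    rw [lintegral_rumLaw_succ]
    simp [lintegral_urnStep, G]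
  have hG' : Measurable (Function.uncurry G) := measurable_of_countable _
  have hG : Measurable fun x : ℕ → ℕ × ℕ => G (x n) (x (n + 1)) :=
    Measurable.comp (g := Function.uncurry G) (f := fun x : ℕ → ℕ × ℕ => (x n, x (n + 1))) hG'
      (by fun_prop)
  filter_upwards [(lintegral_eq_zero_iff hG).1 h] with x hx
  by_contra hne
  simp [G, hne] at hx

lemma lintegral_rumLaw_eq_iterate (k : ℕ) (f : ℕ → ℝ) (n : ℕ) {g : ℕ × ℕ → ℝ} (hg : ∀ s, 0 ≤ g s) :
    ∫⁻ x, ENNReal.ofReal (g (x n)) ∂rumLaw k f =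
      ENNReal.ofReal (((stepMean f)^[n] g) (k, 1)) := by
  induction n generalizing g with
  | zero =>
    have h : ∀ᵐ x ∂rumLaw k f, ENNReal.ofReal (g (x 0)) = ENNReal.ofReal (g (k, 1)) := by
      filter_upwards [rumLaw_ae_zero k f] with x hx
      rw [hx]
    rw [lintegral_congr_ae h]
    simp
  | succ n ih =>
    rw [Function.iterate_succ_apply, ← ih (stepMean_nonneg f hg),
      lintegral_rumLaw_succ k f n fun _ y => ENNReal.ofReal (g y)]
    simp_rw [lintegral_ofReal_urnStep f hg]

/-! ### Red in the lead at a fixed time -/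

/-- The payoff of red in the composition `s`: it is `1` if red leads, `1 / 2` at a tie, and `0` if
white leads. Splitting ties evenly makes the payoffs of the two colours add up to `1`. -/
noncomputable def leadPayoff (s : ℕ × ℕ) : ℝ :=
  if s.1 < s.2 then 1 else if s.1 = s.2 then 1 / 2 else 0

lemma leadPayoff_nonneg (s : ℕ × ℕ) : 0 ≤ leadPayoff s := by
  unfold leadPayoff
  split_ifs <;> norm_num

lemma leadPayoff_add_swap (w r : ℕ) : leadPayoff (w, r) + leadPayoff (r, w) = 1 := by
  rcases lt_trichotomy w r with h | rfl | h
  · simp [leadPayoff, h, h.not_gt, h.ne']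
  · norm_num [leadPayoff]
  · simp [leadPayoff, h, h.not_gt, h.ne']

/-- The expected payoff of red after `n` draws, as a function of the initial composition. -/
noncomputable def leadProb (f : ℕ → ℝ) (n : ℕ) : ℕ × ℕ → ℝ :=
  (stepMean f)^[n] leadPayoff

lemma leadProb_succ (f : ℕ → ℝ) (n : ℕ) (s : ℕ × ℕ) :
    leadProb f (n + 1) s = stepMean f (leadProb f n) s := by
  rw [leadProb, Function.iterate_succ_apply', leadProb]

section

variable {f : ℕ → ℝ} (hf : ∀ j : ℕ, 1 ≤ j → 0 < f j)

include hf

lemma stepMean_eq (g : ℕ × ℕ → ℝ) {w r : ℕ} (hw : 1 ≤ w) (hr : 1 ≤ r) :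
    stepMean f g (w, r) = (f w * g (w + 1, r) + f r * g (w, r + 1)) / (f w + f r) := by
  have h1 := hf w hw
  have h2 := hf r hr
  simp only [stepMean, whiteProb_eq h1 h2]
  field_simp
  ring

/-- The symmetry of the urn under the exchange of the colours. -/
lemma leadProb_add_swap (n : ℕ) {w r : ℕ} (hw : 1 ≤ w) (hr : 1 ≤ r) :
    leadProb f n (w, r) + leadProb f n (r, w) = 1 := by
  induction n generalizing w r with
  | zero => exact leadPayoff_add_swap w r
  | succ n ih =>
    have h1 := hf w hw
    have h2 := hf r hr
    have e1 := ih (w := w + 1) (r := r) (by omega) hr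
    have e2 := ih (w := w) (r := r + 1) hw (by omega)
    rw [leadProb_succ, leadProb_succ, stepMean_eq hf _ hw hr, stepMean_eq hf _ hr hw,
      add_comm (f r) (f w), ← add_div, div_eq_one_iff_eq (by positivity)]
    linear_combination f w * e1 + f r * e2

lemma leadProb_diag (n : ℕ) {w : ℕ} (hw : 1 ≤ w) : leadProb f n (w, w) = 1 / 2 := by
  linarith [leadProb_add_swap hf n hw hw]

end

/-! ### The superharmonic bound below the diagonal -/

/-- The product `∏_{r ≤ l < w} f l F_w / (1 + f l F_w)`. Half of it bounds the probability that
red leads after any fixed number of draws from `w` white and `r ≤ w` red balls. -/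
noncomputable def overtakeBound (f : ℕ → ℝ) (s : ℕ × ℕ) : ℝ :=
  ∏ l ∈ Finset.Ico s.2 s.1, f l * tailSum f s.1 / (1 + f l * tailSum f s.1)

section

variable {f : ℕ → ℝ} (hf : ∀ j : ℕ, 1 ≤ j → 0 < f j)
  (hsum : Summable fun j : ℕ => 1 / f (j + 1))

include hsum in
lemma summable_tail {k : ℕ} (hk : 1 ≤ k) : Summable fun j : ℕ => 1 / f (k + j) := by
  obtain ⟨m, rfl⟩ := Nat.exists_eq_add_of_le' hk
  refine ((summable_nat_add_iff m).2 hsum).congr fun j => ?_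
  rw [show m + 1 + j = j + m + 1 by omega]

include hsum in
lemma tailSum_eq_add {k : ℕ} (hk : 1 ≤ k) : tailSum f k = 1 / f k + tailSum f (k + 1) := by
  rw [tailSum, (summable_tail hsum hk).tsum_eq_zero_add, tailSum]
  simp [add_assoc, add_comm 1]

include hf hsum

lemma tailSum_pos {k : ℕ} (hk : 1 ≤ k) : 0 < tailSum f k :=
  (summable_tail hsum hk).tsum_pos (fun j => (one_div_pos.2 (hf _ (by omega))).le) 0
    (one_div_pos.2 (hf _ (by omega)))

lemma tailSum_succ_le {k : ℕ} (hk : 1 ≤ k) : tailSum f (k + 1) ≤ tailSum f k := by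
  have := one_div_pos.2 (hf k hk)
  linarith [tailSum_eq_add hsum hk]

lemma overtakeBound_add_one_right {w r : ℕ} (hr : 1 ≤ r) (hrw : r < w) :
    f r * overtakeBound f (w, r + 1) = (f r + 1 / tailSum f w) * overtakeBound f (w, r) := by
  have h1 := hf r hr
  have hF := tailSum_pos hf hsum (k := w) (by omega)
  have hB : overtakeBound f (w, r) =
      f r * tailSum f w / (1 + f r * tailSum f w) * overtakeBound f (w, r + 1) :=
    Finset.prod_eq_prod_Ico_succ_bot hrw _
  rw [hB]
  field_simp
  ring

lemma overtakeBound_add_one_left {w r : ℕ} (hr : 1 ≤ r) (hrw : r ≤ w) :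
    overtakeBound f (w + 1, r) ≤ tailSum f (w + 1) / tailSum f w * overtakeBound f (w, r) := by
  have hw : 1 ≤ w := hr.trans hrw
  have h1 := hf w hw
  have hF := tailSum_pos hf hsum hw
  have hF' := tailSum_pos hf hsum (k := w + 1) (by omega)
  have hle := tailSum_succ_le hf hsum hw
  -- The factor of `l = w` is `F_{w+1} / F_w`, as `1 + f w * F_{w+1} = f w * F_w`.
  have hlast : f w * tailSum f (w + 1) / (1 + f w * tailSum f (w + 1)) =
      tailSum f (w + 1) / tailSum f w := by
    rw [tailSum_eq_add hsum hw]
    field_simp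
  have hrest : ∏ l ∈ Finset.Ico r w, f l * tailSum f (w + 1) / (1 + f l * tailSum f (w + 1)) ≤
      overtakeBound f (w, r) := by
    refine Finset.prod_le_prod (fun l hl => ?_) fun l hl => ?_
    · have := hf l (hr.trans (Finset.mem_Ico.1 hl).1)
      positivity
    · have hl := hf l (hr.trans (Finset.mem_Ico.1 hl).1)
      have := mul_le_mul_of_nonneg_left hle hl.le
      change _ ≤ f l * tailSum f w / (1 + f l * tailSum f w)
      rw [div_le_div_iff₀ (by positivity) (by positivity)]
      linarith
  change ∏ l ∈ Finset.Ico r (w + 1), _ ≤ _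
  rw [Finset.prod_Ico_succ_top hrw]
  change _ * (f w * tailSum f (w + 1) / (1 + f w * tailSum f (w + 1))) ≤ _
  rw [hlast, mul_comm]
  exact mul_le_mul_of_nonneg_left hrest (by positivity)

/-- The bound is superharmonic for the urn strictly below the diagonal. -/
lemma stepMean_overtakeBound_le {w r : ℕ} (hr : 1 ≤ r) (hrw : r < w) :
    stepMean f (overtakeBound f) (w, r) ≤ overtakeBound f (w, r) := by
  have hw : 1 ≤ w := by omega
  have h1 := hf w hw
  have h2 := hf r hr
  have hF := tailSum_pos hf hsum hw
  have hL := mul_le_mul_of_nonneg_left (overtakeBound_add_one_left hf hsum hr hrw.le) h1.le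
  have hR := overtakeBound_add_one_right hf hsum hr hrw
  have hc : f w * (tailSum f (w + 1) / tailSum f w) = f w - 1 / tailSum f w := by
    rw [← sub_eq_of_eq_add' (tailSum_eq_add hsum hw)]
    field_simp
  rw [← mul_assoc, hc] at hL
  rw [stepMean_eq hf _ hw hr, div_le_iff₀ (by positivity), hR]
  linarith

lemma leadProb_le (n : ℕ) {w r : ℕ} (hr : 1 ≤ r) (hrw : r ≤ w) :
    leadProb f n (w, r) ≤ 1 / 2 * overtakeBound f (w, r) := by
  induction n generalizing w r with
  | zero =>
    rcases hrw.eq_or_lt with rfl | hlt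
    · simp [leadProb_diag hf 0 hr, overtakeBound]
    · have hF := tailSum_pos hf hsum (hr.trans hrw)
      have hB : 0 ≤ overtakeBound f (w, r) := Finset.prod_nonneg fun l hl => by
        have := hf l (hr.trans (Finset.mem_Ico.1 hl).1)
        simp only
        positivity
      have h0 : leadProb f 0 (w, r) = 0 := by
        simp [leadProb, leadPayoff, hlt.not_gt, hlt.ne']
      rw [h0]
      positivity
  | succ n ih =>
    rcases hrw.eq_or_lt with rfl | hlt
    · simp [leadProb_diag hf _ hr, overtakeBound]
    · have hw : 1 ≤ w := by omega
      have h1 := hf w hw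
      have h2 := hf r hr
      have hs := stepMean_overtakeBound_le hf hsum hr hlt
      rw [stepMean_eq hf _ hw hr, div_le_iff₀ (by positivity)] at hs
      have e1 := mul_le_mul_of_nonneg_left (ih (w := w + 1) hr (by omega)) h1.le
      have e2 := mul_le_mul_of_nonneg_left (ih (w := w) (r := r + 1) (by omega) hlt) h2.le
      rw [leadProb_succ, stepMean_eq hf _ hw hr, div_le_iff₀ (by positivity)]
      linarith

end

/-! ### Finitely many white balls -/

lemma rumLaw_red_leads_le (k : ℕ) (f : ℕ → ℝ) (n : ℕ) :
    rumLaw k f {x | (x n).1 < (x n).2} ≤ ENNReal.ofReal (leadProb f n (k, 1)) := by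
  have hm : MeasurableSet {x : ℕ → ℕ × ℕ | (x n).1 < (x n).2} :=
    measurableSet_lt (measurable_pi_apply n).fst (measurable_pi_apply n).snd
  rw [leadProb, ← lintegral_rumLaw_eq_iterate k f n leadPayoff_nonneg, ← lintegral_indicator_one hm]
  refine lintegral_mono (Set.indicator_le fun x hx => ?_)
  rw [leadPayoff, if_pos (show (x n).1 < (x n).2 from hx)]
  simp

/-- Along a path of the urn with finitely many white draws, red leads from some time on: the number
of white balls is eventually constant, and the total number of balls tends to infinity. -/
lemma exists_forall_red_leads {k : ℕ} {x : ℕ → ℕ × ℕ} (h0 : x 0 = (k, 1))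
    (hstep : ∀ n, x (n + 1) = ((x n).1 + 1, (x n).2) ∨ x (n + 1) = ((x n).1, (x n).2 + 1))
    (hx : x ∈ finitelyManyWhite) : ∃ N, ∀ n ≥ N, (x n).1 < (x n).2 := by
  obtain ⟨N, hN⟩ := Set.Finite.bddAbove hx
  have htot : ∀ n, (x n).1 + (x n).2 = n + k + 1 := by
    intro n
    induction n with
    | zero => simp [h0]
    | succ n ih => rcases hstep n with h | h <;> rw [h] <;> simp only <;> omega
  have hconst : ∀ m, (x (N + 1 + m)).1 = (x (N + 1)).1 := by
    intro m
    induction m with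
    | zero => rfl
    | succ m ih =>
      rcases hstep (N + 1 + m) with h | h
      · have : N + 1 + m ≤ N := hN (by simp [h])
        omega
      · rw [← add_assoc, h]
        exact ih
  refine ⟨N + 1 + 2 * (x (N + 1)).1, fun n hn => ?_⟩
  obtain ⟨m, rfl⟩ := Nat.exists_eq_add_of_le (show N + 1 ≤ n by omega)
  have h1 := hconst m
  have h2 := htot (N + 1 + m)
  omega

lemma rumLaw_finitelyManyWhite_le (k : ℕ) (f : ℕ → ℝ) {c : ENNReal}
    (hc : ∀ n, rumLaw k f {x | (x n).1 < (x n).2} ≤ c) : rumLaw k f finitelyManyWhite ≤ c := by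
  let A : ℕ → Set (ℕ → ℕ × ℕ) := fun N => {x | ∀ n ≥ N, (x n).1 < (x n).2}
  have hA : Monotone A := fun M N hMN x hx n hn => hx n (hMN.trans hn)
  calc rumLaw k f finitelyManyWhite ≤ rumLaw k f (⋃ N, A N) := by
        refine measure_mono_ae ?_
        filter_upwards [rumLaw_ae_zero k f, rumLaw_ae_step k f] with x h0 hstep hx
        exact Set.mem_iUnion.2 (exists_forall_red_leads h0 hstep hx)
    _ = ⨆ N, rumLaw k f (A N) := hA.measure_iUnion
    _ ≤ c := iSup_le fun N => (measure_mono fun x (hx : x ∈ A N) => hx N le_rfl).trans (hc N)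

theorem theorem1p6 (f : ℕ → ℝ) (hf : ∀ j : ℕ, 1 ≤ j → 0 < f j)
    (hsum : Summable fun j : ℕ => 1 / f (j + 1)) (k : ℕ) (hk : 1 ≤ k) :
    (rumLaw k f).real finitelyManyWhite ≤
      1 / 2 * ∏ l ∈ Finset.Icc 1 (k - 1),
        f l * tailSum f k / (1 + f l * tailSum f k) := by
  have hI : Finset.Icc 1 (k - 1) = Finset.Ico 1 k := by
    ext l
    simp only [Finset.mem_Icc, Finset.mem_Ico]
    omega
  rw [hI]
  have hF := tailSum_pos hf hsum hk
  refine ENNReal.toReal_le_of_le_ofReal ?_ (rumLaw_finitelyManyWhite_le k f fun n =>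
    (rumLaw_red_leads_le k f n).trans
      (ENNReal.ofReal_le_ofReal (leadProb_le hf hsum n le_rfl hk)))
  refine mul_nonneg (by norm_num) (Finset.prod_nonneg fun l hl => ?_)
  have := hf l (Finset.mem_Ico.1 hl).1
  positivity
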